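/- Let $H$ be a (real or complex) Hilbert space and let $A$, $G$ be linear maximal monotone operators on $H$. For a linear maximal monotone operator $L$ on $H$, let $S_L$ denote the strongly continuous semigroup of contractions on $H$ generated by $-L$. For a positive integer $k$ let $G^k$ be the $k$-th power of $G$ with its natural domain $\mathsf{D}(G^k)$, equipped with the scalar product $$\langle \phi,\psi\rangle_{\mathsf{D}(G^k)} := \langle \phi,\psi\rangle + \langle G\phi,G\psi\rangle + \cdots + \langle G^k\phi,G^k\psi\rangle .$$ Assume that there exists $\varepsilon_0>0$ such that, for every $\varepsilon \in (0,\varepsilon_0]$, the closure of $A+\varepsilon G$ (defined on $\mathsf{D}(A)\cap\mathsf{D}(G)$) is maximal monotone, and denote this closure again by $A+\varepsilon G$. Assume moreover that there exist an integer $m\ge 1$ and real constants $\alpha_1,\dots,\alpha_{m+1}$ such that, for every $k\in\{1,\dots,m+1\}$, every $\phi\in\mathsf{D}(G^k)$ and every $t\ge 0$, one has $S_A(t)\phi\in\mathsf{D}(G^k)$ and $$\|G^k S_A(t)\phi\| \le e^{\alpha_k t}\,\|G^k\phi\| .$$ Then, for every $k\in\{1,\dots,m+1\}$, the space $\mathsf{D}(G^k)$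 with the above scalar product is a Hilbert space and, for every $\varepsilon\in(0,\varepsilon_0]$, the operators $S_A(t)$ and $S_{A+\varepsilon G}(t)$, $t \ge 0$, map $\mathsf{D}(G^k)$ into itself and their restrictions to $\mathsf{D}(G^k)$ form strongly continuous quasi-contraction semigroups on the Hilbert space $\mathsf{D}(G^k)$; that is, they are semigroups of bounded linear operators on $\mathsf{D}(G^k)$ with continuous orbits, and their operator norms on $\mathsf{D}(G^k)$ are bounded by $e^{\omega t}$ for all $t\ge 0$, for some $\omega\in\mathbb{R}$. -/

import Mathlib

open scoped NNReal InnerProductSpace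
open Filter Topology

namespace OpSemigroup

section Operators

variable {𝕜 : Type*} [RCLike 𝕜] {H : Type*} [NormedAddCommGroup H] [InnerProductSpace 𝕜 H]

/-- A (partially defined) linear operator is monotone if `Re ⟪A x, x⟫ ≥ 0` on its domain. -/
def IsMonotone (A : H →ₗ.[𝕜] H) : Prop :=
  ∀ x : A.domain, 0 ≤ RCLike.re ⟪A x, (x : H)⟫_𝕜

/-- A linear operator is maximal monotone if it is monotone and its graph is maximal among the
monotone subsets of `H × H`: every pair `(x, y)` that is monotonically related to all points of
the graph already lies on the graph. -/
def IsMaximalMonotone (A : H →ₗ.[𝕜] H) : Prop :=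
  IsMonotone A ∧
    ∀ x y : H, (∀ z : A.domain, 0 ≤ RCLike.re ⟪y - A z, x - (z : H)⟫_𝕜) → (x, y) ∈ A.graph

/-- Composition `B ∘ A` of partially defined operators on its natural domain
`{x ∈ D(A) | A x ∈ D(B)}`. -/
def compose (B A : H →ₗ.[𝕜] H) : H →ₗ.[𝕜] H where
  domain := (B.domain.comap A.toFun).map A.domain.subtype
  toFun := (B.comp (A.domRestrict ((B.domain.comap A.toFun).map A.domain.subtype)) (by
      rintro ⟨x, hx, hxA⟩
      obtain ⟨z, hz, rfl⟩ := hx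
      exact hz)).toFun ∘ₗ Submodule.inclusion (by
        rintro x hx
        refine ⟨hx, ?_⟩
        obtain ⟨z, -, rfl⟩ := hx
        exact z.2)

theorem mem_compose_domain_iff (B A : H →ₗ.[𝕜] H) (x : H) :
    x ∈ (compose B A).domain ↔ ∃ hx : x ∈ A.domain, A ⟨x, hx⟩ ∈ B.domain := by
  constructor
  · rintro ⟨z, hz, rfl⟩
    exact ⟨z.2, hz⟩
  · rintro ⟨hx, h⟩
    exact ⟨⟨x, hx⟩, h, rfl⟩

theorem compose_apply (B A : H →ₗ.[𝕜] H) (x : H) (h : x ∈ (compose B A).domain)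
    (hx : x ∈ A.domain) (hAx : A ⟨x, hx⟩ ∈ B.domain) :
    compose B A ⟨x, h⟩ = B ⟨A ⟨x, hx⟩, hAx⟩ := rfl

/-- Powers of a partially defined operator: `G ^ 0` is the identity on all of `H`, and
`G ^ (k + 1) = G ∘ G ^ k` on the domain `{x ∈ D(G ^ k) | G ^ k x ∈ D(G)}`. -/
def opPow (G : H →ₗ.[𝕜] H) : ℕ → (H →ₗ.[𝕜] H)
  | 0 => LinearMap.id.toPMap ⊤
  | k + 1 => compose G (opPow G k)

theorem opPow_domain_antitone (G : H →ₗ.[𝕜] H) : Antitone fun k => (opPow G k).domain :=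
  antitone_nat_of_succ_le fun k x hx => ((mem_compose_domain_iff G (opPow G k) x).1 hx).1

/-- The vector space `D(G ^ k)`, as a type of its own so that it can carry the graph inner
product instead of the one inherited from `H`. -/
def PowDomain (G : H →ₗ.[𝕜] H) (k : ℕ) : Type _ := (opPow G k).domain

namespace PowDomain

variable (G : H →ₗ.[𝕜] H) (k : ℕ)

instance instAddCommGroup : AddCommGroup (PowDomain G k) :=
  inferInstanceAs (AddCommGroup (opPow G k).domain)

instance instModule : Module 𝕜 (PowDomain G k) :=
  inferInstanceAs (Module 𝕜 (opPow G k).domain)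

/-- The inclusion of `D(G ^ k)` into `H`. -/
def incl : PowDomain G k →ₗ[𝕜] H := (opPow G k).domain.subtype

/-- The operator `G ^ j` on `D(G ^ k)`, for `j ≤ k`. -/
def pow (j : Fin (k + 1)) : PowDomain G k →ₗ[𝕜] H :=
  (opPow G j).toFun ∘ₗ
    Submodule.inclusion (opPow_domain_antitone G (Nat.lt_succ_iff.1 j.2))

theorem pow_zero_apply (x : PowDomain G k) : pow G k 0 x = incl G k x := rfl

/-- The inner product `⟪φ, ψ⟫ + ⟪G φ, G ψ⟫ + ⋯ + ⟪G ^ k φ, G ^ k ψ⟫` on `D(G ^ k)`. -/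
noncomputable abbrev core : InnerProductSpace.Core 𝕜 (PowDomain G k) where
  inner x y := ∑ j : Fin (k + 1), ⟪pow G k j x, pow G k j y⟫_𝕜
  conj_inner_symm x y := by simp [map_sum]
  re_inner_nonneg x := by
    rw [map_sum]
    exact Finset.sum_nonneg fun j _ => inner_self_nonneg
  add_left x y z := by simp [inner_add_left, Finset.sum_add_distrib]
  smul_left x y r := by simp [inner_smul_left, Finset.mul_sum]
  definite x h := by
    have h' : ∑ j : Fin (k + 1), RCLike.re ⟪pow G k j x, pow G k j x⟫_𝕜 = 0 := by
      rw [← map_sum]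
      exact (congrArg RCLike.re h).trans (map_zero _)
    have h0 := (Finset.sum_eq_zero_iff_of_nonneg fun j _ => inner_self_nonneg).1 h' 0
      (Finset.mem_univ _)
    rw [pow_zero_apply, inner_self_eq_norm_sq] at h0
    exact Subtype.ext (norm_eq_zero.1 (pow_eq_zero_iff two_ne_zero |>.1 h0))

noncomputable instance instNormedAddCommGroup : NormedAddCommGroup (PowDomain G k) :=
  (core G k).toNormedAddCommGroup

noncomputable instance instInnerProductSpace : InnerProductSpace 𝕜 (PowDomain G k) :=
  InnerProductSpace.ofCore (core G k).toCore

theorem inner_def (x y : PowDomain G k) :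
    ⟪x, y⟫_𝕜 = ∑ j : Fin (k + 1), ⟪pow G k j x, pow G k j y⟫_𝕜 := rfl

end PowDomain

end Operators

section Semigroups

variable {𝕜 : Type*} [RCLike 𝕜] {X : Type*} [NormedAddCommGroup X] [NormedSpace 𝕜 X]

/-- `S` is a strongly continuous semigroup of bounded linear operators on `X`. -/
structure IsC0Semigroup (S : ℝ≥0 → X →L[𝕜] X) : Prop where
  map_zero : S 0 = ContinuousLinearMap.id 𝕜 X
  map_add : ∀ s t : ℝ≥0, S (s + t) = (S s).comp (S t)
  continuous_orbit : ∀ x : X, Continuous fun t : ℝ≥0 => S t x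

/-- `S` is a strongly continuous quasi-contraction semigroup on `X`. -/
structure IsQuasiContractionSemigroup (S : ℝ≥0 → X →L[𝕜] X) : Prop extends IsC0Semigroup S where
  exists_norm_le : ∃ ω : ℝ, ∀ t : ℝ≥0, ‖S t‖ ≤ Real.exp (ω * t)

/-- `S` is the strongly continuous semigroup of contractions on `X` generated by `-A`: it is a
strongly continuous semigroup of contractions, and its infinitesimal generator
(the right derivative of the orbits at `0`, on the domain where that derivative exists)
is the operator `-A`, domains included. -/
structure IsContractionSemigroupOf (A : X →ₗ.[𝕜] X) (S : ℝ≥0 → X →L[𝕜] X) : Prop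
    extends IsC0Semigroup S where
  norm_le_one : ∀ t : ℝ≥0, ‖S t‖ ≤ 1
  mem_graph_iff : ∀ x y : X, (x, y) ∈ A.graph ↔
    Tendsto (fun t : ℝ≥0 => (((t : ℝ) : 𝕜))⁻¹ • (S t x - x)) (𝓝[>] 0) (𝓝 (-y))

end Semigroups

/-- The operators `S t` map `D(G ^ k)` into itself, and their restrictions to `D(G ^ k)` form a
strongly continuous quasi-contraction semigroup for the graph norm of `D(G ^ k)`. -/
def RestrictsToQuasiContractionSemigroup {𝕜 : Type*} [RCLike 𝕜] {H : Type*}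
    [NormedAddCommGroup H] [InnerProductSpace 𝕜 H]
    (S : ℝ≥0 → H →L[𝕜] H) (G : H →ₗ.[𝕜] H) (k : ℕ) : Prop :=
  ∃ T : ℝ≥0 → PowDomain G k →L[𝕜] PowDomain G k,
    (∀ (t : ℝ≥0) (φ : PowDomain G k),
      PowDomain.incl G k (T t φ) = S t (PowDomain.incl G k φ)) ∧
    IsQuasiContractionSemigroup T

end OpSemigroup

/-! Write `E` for `D(G^k)` with its graph norm and `ι : E → H` for the inclusion. `E` is complete
because `G` has closed graph. Everything else is a bound on `E`, carried by `LiftsWithBound`: an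
operator on `H` preserves the range of `ι` and is controlled there by a constant.

For `S_A` the bound `exp (ω t)` comes from the hypothesis on each `G^j`. For the closure `B` of `A +
εG`, the products `F h = (1 + hεG)⁻¹ S_A(h)` are contractions on `H` with the same bound `exp (ω h)`
on `E`, since resolvents of `G` are contractions commuting with powers of `G`. Their difference
quotients converge to `A + εG` on `D(A) ∩ D(G)`, hence on a set whose closure contains the graph of
`B`. As in Chernoff's theorem, `(1 + (μ/h)(1 - F h))⁻¹` converges strongly to the resolvent of `B`,
which inherits the bound `(1 - ωμ)⁻¹` on `E` (`IsResolvent.liftsWithBound`). The exponential formula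
turns this into `exp (ω t)` for the semigroup.

Bounds on `E` survive limits taken only in `H`, because balls of `E` are weakly compact and so have
closed image in `H` (`exists_norm_le_of_tendsto`). Strong continuity on `E` then follows from weak
continuity at `0` and the norm bound. -/

namespace OpSemigroup

/-! ### Bounded operators: dense sets, powers of contractions, Neumann series -/

section Density

variable {𝕜 : Type*} [RCLike 𝕜] {X Y : Type*} [NormedAddCommGroup X] [NormedSpace 𝕜 X]
  [NormedAddCommGroup Y] [NormedSpace 𝕜 Y]

/-- Strong convergence of uniformly bounded operators may be checked on a dense set. -/
theorem tendsto_apply_of_dense {α : Type*} {l : Filter α} {U : α → X →L[𝕜] Y} {V : X →L[𝕜] Y}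
    {C : ℝ} (hU : ∀ᶠ a in l, ‖U a‖ ≤ C) {D : Set X} (hD : Dense D)
    (h : ∀ x ∈ D, Tendsto (fun a => U a x) l (𝓝 (V x))) (x : X) :
    Tendsto (fun a => U a x) l (𝓝 (V x)) := by
  rw [Metric.tendsto_nhds]
  intro δ hδ
  have hK : 0 < |C| + ‖V‖ + 1 := by positivity
  obtain ⟨y, hy, hxy⟩ := hD.exists_dist_lt x (show 0 < δ / 2 / (|C| + ‖V‖ + 1) by positivity)
  filter_upwards [hU, (Metric.tendsto_nhds.1 (h y hy)) (δ / 2) (half_pos hδ)] with a ha hay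
  rw [dist_eq_norm] at *
  have e : U a x - V x = U a (x - y) + (U a y - V y) - V (x - y) := by
    simp only [map_sub]; abel
  have h1 : ‖U a (x - y)‖ ≤ |C| * ‖x - y‖ :=
    ((U a).le_opNorm _).trans (by gcongr; exact ha.trans (le_abs_self C))
  have h2 := V.le_opNorm (x - y)
  have h3 : (|C| + ‖V‖ + 1) * ‖x - y‖ < δ / 2 := by
    rwa [lt_div_iff₀ hK, mul_comm] at hxy
  have h4 := norm_nonneg (x - y)
  calc ‖U a x - V x‖ ≤ ‖U a (x - y)‖ + ‖U a y - V y‖ + ‖V (x - y)‖ := by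
        rw [e]; exact (norm_sub_le _ _).trans (by gcongr; exact norm_add_le _ _)
    _ < δ := by nlinarith

/-- Powers of commuting contractions stay close. -/
theorem norm_pow_apply_sub_pow_apply_le {J S : X →L[𝕜] X} (hJ : ‖J‖ ≤ 1) (hS : ‖S‖ ≤ 1)
    (hJS : Commute J S) (n : ℕ) (x : X) :
    ‖(J ^ n) x - (S ^ n) x‖ ≤ n * ‖J x - S x‖ := by
  induction n with
  | zero => simp
  | succ n ih =>
    have hc : J ((S ^ n) x) = (S ^ n) (J x) :=
      congrArg (fun T : X →L[𝕜] X => T x) (hJS.pow_right n).eq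
    have e : (J ^ (n + 1)) x - (S ^ (n + 1)) x =
        J ((J ^ n) x - (S ^ n) x) + (S ^ n) (J x - S x) := by
      rw [map_sub, map_sub, hc, pow_succ', pow_succ]
      simp
    have hSn : ‖(S ^ n)‖ ≤ 1 := by
      rcases n.eq_zero_or_pos with rfl | hn
      · exact ContinuousLinearMap.norm_id_le
      · exact (norm_pow_le' S hn).trans (pow_le_one₀ (norm_nonneg _) hS)
    rw [e, Nat.cast_succ]
    have h1 := J.le_of_opNorm_le hJ ((J ^ n) x - (S ^ n) x)
    have h2 := (S ^ n).le_of_opNorm_le hSn (J x - S x)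
    refine (norm_add_le _ _).trans ?_
    linarith

/-- `a - T` is invertible for `‖T‖ < a`, with the expected bound. -/
theorem exists_smul_sub_apply_eq [CompleteSpace X] {T : X →L[𝕜] X} {a c : ℝ} (hT : ‖T‖ ≤ c)
    (hca : c < a) (φ : X) :
    ∃ v : X, (a : 𝕜) • v - T v = φ ∧ (a - c) * ‖v‖ ≤ ‖φ‖ := by
  have ha : 0 < a := ((norm_nonneg T).trans hT).trans_lt hca
  have ha' : (a : 𝕜) ≠ 0 := by exact_mod_cast ha.ne'
  have hn : ‖((a : 𝕜)⁻¹ • T)‖ < 1 := by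
    rw [norm_smul, norm_inv, RCLike.norm_ofReal, abs_of_pos ha, inv_mul_lt_iff₀ ha]
    linarith
  set u := Units.oneSub ((a : 𝕜)⁻¹ • T) hn with hu
  set v : X := (a : 𝕜)⁻¹ • ((↑u⁻¹ : X →L[𝕜] X) φ) with hv
  have hv1 : (a : 𝕜) • v = (↑u⁻¹ : X →L[𝕜] X) φ := by rw [hv, smul_inv_smul₀ ha']
  have h1 : (a : 𝕜) • v - T v = φ := by
    have h2 : (u : X →L[𝕜] X) ((↑u⁻¹ : X →L[𝕜] X) φ) = φ :=
      congrArg (fun T : X →L[𝕜] X => T φ) u.mul_inv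
    have h3 : (u : X →L[𝕜] X) = 1 - (a : 𝕜)⁻¹ • T := rfl
    rw [← hv1, h3] at h2
    simpa [smul_sub, smul_smul, ha'] using h2
  refine ⟨v, h1, ?_⟩
  have h4 := T.le_of_opNorm_le hT v
  have h5 : ‖(a : 𝕜) • v‖ = a * ‖v‖ := by rw [norm_smul, RCLike.norm_ofReal, abs_of_pos ha]
  have h6 := norm_sub_norm_le ((a : 𝕜) • v) (T v)
  rw [h1, h5] at h6
  linarith

end Density

/-! ### Maximal monotone operators and their resolvents -/

section MaximalMonotone

variable {𝕜 : Type*} [RCLike 𝕜] {H : Type*} [NormedAddCommGroup H] [InnerProductSpace 𝕜 H]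
  {L : H →ₗ.[𝕜] H}

theorem IsMonotone.re_inner_nonneg (hL : IsMonotone L) {x y : H} (h : (x, y) ∈ L.graph) :
    0 ≤ RCLike.re ⟪y, x⟫_𝕜 := by
  obtain ⟨z, rfl, rfl⟩ := (LinearPMap.mem_graph_iff L).1 h
  exact hL z

theorem IsMaximalMonotone.mem_graph (hL : IsMaximalMonotone L) {x y : H}
    (h : ∀ z w, (z, w) ∈ L.graph → 0 ≤ RCLike.re ⟪y - w, x - z⟫_𝕜) : (x, y) ∈ L.graph :=
  hL.2 x y fun z => h _ _ (L.mem_graph z)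

/-- Being monotonically related to a fixed graph point is a closed condition, so limits of graph
points satisfy it, and maximality puts them back on the graph. -/
theorem IsMaximalMonotone.isClosed_graph (hL : IsMaximalMonotone L) :
    IsClosed (L.graph : Set (H × H)) := by
  refine isClosed_of_closure_subset fun p hp => ?_
  refine hL.mem_graph (x := p.1) (y := p.2) fun z w hzw => ?_
  have hcl : IsClosed {q : H × H | 0 ≤ RCLike.re ⟪q.2 - w, q.1 - z⟫_𝕜} :=
    isClosed_le continuous_const (by fun_prop)
  refine closure_minimal (fun q hq => ?_) hcl hp
  exact hL.1.re_inner_nonneg (L.graph.sub_mem (show (q.1, q.2) ∈ L.graph from hq) hzw)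

/-- If `z` is orthogonal to the domain, then `(0, z)` is monotonically related to the graph, hence
lies on it, and `z = L 0 = 0`. -/
theorem IsMaximalMonotone.dense_domain [CompleteSpace H] (hL : IsMaximalMonotone L) :
    Dense (L.domain : Set H) := by
  rw [Submodule.dense_iff_topologicalClosure_eq_top, Submodule.topologicalClosure_eq_top_iff,
    Submodule.eq_bot_iff]
  intro z hz
  have h0 : ((0 : H), z) ∈ L.graph := by
    refine hL.mem_graph fun x w hxw => ?_
    have h1 : ⟪z, x⟫_𝕜 = 0 := by
      rw [← inner_conj_symm, (Submodule.mem_orthogonal _ _).1 hz x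
        (LinearPMap.mem_domain_of_mem_graph hxw), map_zero]
    have h2 := hL.1.re_inner_nonneg hxw
    simp [inner_sub_left, inner_neg_right, h1, h2]
  exact LinearPMap.graph_fst_eq_zero_snd L h0 rfl

theorem IsMonotone.norm_le_norm_add_smul (hL : IsMonotone L) {μ : ℝ} (hμ : 0 ≤ μ) {x y : H}
    (h : (x, y) ∈ L.graph) : ‖x‖ ≤ ‖x + (μ : 𝕜) • y‖ := by
  have h1 := re_inner_le_norm (𝕜 := 𝕜) (x + (μ : 𝕜) • y) x
  rw [inner_add_left, inner_smul_left, RCLike.conj_ofReal, map_add, RCLike.re_ofReal_mul,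
    inner_self_eq_norm_sq] at h1
  have h2 := mul_nonneg hμ (hL.re_inner_nonneg h)
  rcases (norm_nonneg x).eq_or_lt with h0 | h0
  · rw [← h0]; positivity
  · nlinarith

/-- `J` is the resolvent `(1 + μ L)⁻¹`, and it is a contraction. -/
structure IsResolvent (L : H →ₗ.[𝕜] H) (μ : ℝ) (J : H →L[𝕜] H) : Prop where
  mem_graph : ∀ x, (J x, (μ : 𝕜)⁻¹ • (x - J x)) ∈ L.graph
  apply_add : ∀ {x y}, (x, y) ∈ L.graph → J (x + (μ : 𝕜) • y) = x
  norm_le_one : ‖J‖ ≤ 1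

/-- Minty's theorem for linear operators. -/
theorem IsMaximalMonotone.exists_isResolvent [CompleteSpace H] (hL : IsMaximalMonotone L)
    {μ : ℝ} (hμ : 0 < μ) : ∃ J, IsResolvent L μ J := by
  have hμ' : (μ : 𝕜) ≠ 0 := by exact_mod_cast hμ.ne'
  let Φ : L.graph →L[𝕜] H :=
    (ContinuousLinearMap.fst 𝕜 H H + (μ : 𝕜) • ContinuousLinearMap.snd 𝕜 H H).comp
      L.graph.subtypeL
  have hΦ : ∀ p : L.graph, Φ p = p.1.1 + (μ : 𝕜) • p.1.2 := fun p => rfl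
  have hfst : ∀ p : L.graph, ‖p.1.1‖ ≤ ‖Φ p‖ := fun p =>
    hL.1.norm_le_norm_add_smul hμ.le (x := p.1.1) (y := p.1.2) p.2
  have hsnd : ∀ p : L.graph, ‖p.1.2‖ ≤ 2 / μ * ‖Φ p‖ := fun p => by
    have h1 : ‖(μ : 𝕜) • p.1.2‖ ≤ ‖Φ p‖ + ‖p.1.1‖ := by
      rw [show (μ : 𝕜) • p.1.2 = Φ p - p.1.1 by rw [hΦ]; abel]
      exact norm_sub_le _ _
    rw [norm_smul, RCLike.norm_ofReal, abs_of_pos hμ] at h1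
    have := hfst p
    rw [div_mul_eq_mul_div, le_div_iff₀ hμ]
    linarith
  have hanti : AntilipschitzWith ⟨1 + 2 / μ, by positivity⟩ Φ := by
    refine Φ.antilipschitz_of_bound fun p => ?_
    change max ‖p.1.1‖ ‖p.1.2‖ ≤ (1 + 2 / μ) * ‖Φ p‖
    have := hfst p
    have := hsnd p
    have h3 : 0 ≤ 2 / μ * ‖Φ p‖ := by positivity
    have h4 := norm_nonneg (Φ p)
    exact max_le (by linarith) (by linarith)
  have : CompleteSpace L.graph := hL.isClosed_graph.completeSpace_coe
  -- `(x, y) ↦ x + μ y` is bounded below on the complete space `L.graph`, so its range is closed and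
  -- only density remains.
  have hclosed : IsClosed (Set.range Φ) := hanti.isClosed_range Φ.uniformContinuous
  have hsurj : Function.Surjective Φ := by
    have hcr : IsClosed ((LinearMap.range (Φ : L.graph →ₗ[𝕜] H) : Submodule 𝕜 H) : Set H) := by
      simpa [LinearMap.coe_range] using hclosed
    have : CompleteSpace (LinearMap.range (Φ : L.graph →ₗ[𝕜] H)) := hcr.completeSpace_coe
    have : LinearMap.range (Φ : L.graph →ₗ[𝕜] H) = ⊤ := by
      rw [← Submodule.orthogonal_eq_bot_iff, Submodule.eq_bot_iff]
      intro z hz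
      have horth : ∀ {w g : H}, (w, g) ∈ L.graph → ⟪w + (μ : 𝕜) • g, z⟫_𝕜 = 0 := fun {w g} h =>
        (Submodule.mem_orthogonal _ _).1 hz _ ⟨⟨(w, g), h⟩, rfl⟩
      -- For `z` orthogonal to the range, the monotonicity pairing of `(μ z, z)` with `(w, g)`
      -- reduces to `μ ‖z‖² + Re ⟪g, w⟫ ≥ 0`. Once this pair is on the graph, orthogonality applied
      -- to it gives `2 μ ‖z‖² = 0`.
      have hmem : ((μ : 𝕜) • z, z) ∈ L.graph := by
        refine hL.mem_graph fun w g hwg => ?_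
        have h1 := congrArg RCLike.re (horth hwg)
        have h2 := hL.1.re_inner_nonneg hwg
        rw [inner_add_left, inner_smul_left, RCLike.conj_ofReal, map_add, RCLike.re_ofReal_mul,
          map_zero, ← inner_re_symm] at h1
        rw [inner_sub_left, inner_sub_right, inner_sub_right, inner_smul_right, inner_smul_right]
        simp only [map_sub, RCLike.re_ofReal_mul, inner_self_eq_norm_sq]
        nlinarith [sq_nonneg ‖z‖]
      have h3 := congrArg RCLike.re (horth hmem)
      rw [inner_add_left, inner_smul_left, RCLike.conj_ofReal, map_add, RCLike.re_ofReal_mul,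
        map_zero, inner_self_eq_norm_sq] at h3
      have h4 : ‖z‖ ^ 2 = 0 := by nlinarith [sq_nonneg ‖z‖]
      simpa using h4
    exact LinearMap.range_eq_top.1 this
  let e := LinearEquiv.ofBijective (Φ : L.graph →ₗ[𝕜] H) ⟨hanti.injective, hsurj⟩
  have he : ∀ x, Φ (e.symm x) = x := fun x => e.apply_symm_apply x
  let J : H →L[𝕜] H := LinearMap.mkContinuous
    ((LinearMap.fst 𝕜 H H).comp (L.graph.subtype.comp (e.symm : H →ₗ[𝕜] L.graph))) 1 fun x => by
      have := hfst (e.symm x)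
      rw [he] at this
      simpa using this
  have hJ : ∀ x, J x = (e.symm x).1.1 := fun x => rfl
  refine ⟨J, fun x => ?_, fun {x y} h => ?_, LinearMap.mkContinuous_norm_le _ zero_le_one _⟩
  · have h1 : (μ : 𝕜)⁻¹ • (x - J x) = (e.symm x).1.2 := by
      have h2 := he x
      rw [hΦ, ← hJ] at h2
      rw [inv_smul_eq_iff₀ hμ', eq_comm]
      exact eq_sub_of_add_eq' h2
    rw [h1]
    exact (e.symm x).2
  · have : e.symm (x + (μ : 𝕜) • y) = ⟨(x, y), h⟩ := by
      rw [LinearEquiv.symm_apply_eq]; rfl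
    rw [hJ, this]

theorem IsMaximalMonotone.exists_resolvents [CompleteSpace H] (hL : IsMaximalMonotone L) :
    ∃ J : ℝ≥0 → H →L[𝕜] H, ∀ μ : ℝ≥0, 0 < μ → IsResolvent L μ (J μ) := by
  have h : ∀ μ : ℝ≥0, ∃ J : H →L[𝕜] H, 0 < μ → IsResolvent L μ J := fun μ => by
    by_cases hμ : 0 < μ
    · obtain ⟨J, hJ⟩ := hL.exists_isResolvent (μ := μ) (by exact_mod_cast hμ)
      exact ⟨J, fun _ => hJ⟩
    · exact ⟨0, fun h => absurd h hμ⟩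
  choose J hJ using h
  exact ⟨J, hJ⟩

theorem IsResolvent.apply_snd {μ : ℝ} {J : H →L[𝕜] H} (hJ : IsResolvent L μ J) (hμ : μ ≠ 0)
    {x y : H} (h : (x, y) ∈ L.graph) : J y = (μ : 𝕜)⁻¹ • (x - J x) := by
  have hμ' : (μ : 𝕜) ≠ 0 := by exact_mod_cast hμ
  have h1 := hJ.apply_add h
  rw [map_add, map_smul] at h1
  rw [eq_inv_smul_iff₀ hμ']
  exact eq_sub_of_add_eq' h1

theorem IsResolvent.map_mem_graph {μ : ℝ} {J : H →L[𝕜] H} (hJ : IsResolvent L μ J) (hμ : μ ≠ 0)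
    {x y : H} (h : (x, y) ∈ L.graph) : (J x, J y) ∈ L.graph := by
  rw [hJ.apply_snd hμ h]
  exact hJ.mem_graph x

/-- On the domain `x - J μ x = μ J μ (L x)` has norm at most `μ ‖L x‖`; density and contractivity
give the rest. -/
theorem tendsto_resolvent_apply [CompleteSpace H] (hL : IsMaximalMonotone L)
    {J : ℝ≥0 → H →L[𝕜] H} (hJ : ∀ μ : ℝ≥0, 0 < μ → IsResolvent L μ (J μ)) (x : H) :
    Tendsto (fun μ => J μ x) (𝓝[>] 0) (𝓝 x) := by
  refine tendsto_apply_of_dense (V := ContinuousLinearMap.id 𝕜 H) (C := 1)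
    (eventually_mem_nhdsWithin.mono fun μ hμ => (hJ μ hμ).norm_le_one) hL.dense_domain
    (fun x hx => ?_) x
  rw [tendsto_iff_norm_sub_tendsto_zero]
  have h0 : Tendsto (fun μ : ℝ≥0 => (μ : ℝ) * ‖L ⟨x, hx⟩‖) (𝓝[>] 0) (𝓝 0) := by
    have : Tendsto (fun μ : ℝ≥0 => (μ : ℝ) * ‖L ⟨x, hx⟩‖) (𝓝 0) (𝓝 (((0 : ℝ≥0) : ℝ) * ‖L ⟨x, hx⟩‖)) :=
      (NNReal.continuous_coe.mul continuous_const).tendsto 0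
    simpa using this.mono_left nhdsWithin_le_nhds
  refine squeeze_zero' (Eventually.of_forall fun _ => norm_nonneg _) ?_ h0
  filter_upwards [self_mem_nhdsWithin] with μ hμ
  have hμ0 : (0 : ℝ) < μ := by exact_mod_cast hμ
  have hμ' : ((μ : ℝ) : 𝕜) ≠ 0 := by exact_mod_cast hμ0.ne'
  have h1 := (hJ μ hμ).apply_snd hμ0.ne' (L.mem_graph ⟨x, hx⟩)
  have h2 : x - J μ x = ((μ : ℝ) : 𝕜) • J μ (L ⟨x, hx⟩) := by
    rw [h1, smul_inv_smul₀ hμ']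
  rw [norm_sub_rev]
  change ‖x - J μ x‖ ≤ _
  rw [h2, norm_smul, RCLike.norm_ofReal, abs_of_pos hμ0]
  have := (J μ).le_of_opNorm_le (hJ μ hμ).norm_le_one (L ⟨x, hx⟩)
  gcongr
  linarith

end MaximalMonotone

/-! ### Bounds on a Hilbert space embedded in `H` -/

section Lifting

variable {𝕜 : Type*} [RCLike 𝕜] {H E : Type*} [NormedAddCommGroup H] [InnerProductSpace 𝕜 H]
  [NormedAddCommGroup E] [InnerProductSpace 𝕜 E] {ι : E →L[𝕜] H}

/-- `T` maps the range of `ι` into itself, with bound `c` for the norm of `E`. -/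
def LiftsWithBound (ι : E →L[𝕜] H) (T : H →L[𝕜] H) (c : ℝ) : Prop :=
  ∀ φ : E, ∃ ψ : E, ι ψ = T (ι φ) ∧ ‖ψ‖ ≤ c * ‖φ‖

theorem LiftsWithBound.pow {T : H →L[𝕜] H} {c : ℝ} (hc : 0 ≤ c) (h : LiftsWithBound ι T c)
    (n : ℕ) : LiftsWithBound ι (T ^ n) (c ^ n) := by
  induction n with
  | zero => exact fun φ => ⟨φ, by simp, by simp⟩
  | succ n ih =>
    intro φ
    obtain ⟨ψ, h1, h2⟩ := ih φ
    obtain ⟨χ, h3, h4⟩ := h ψ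
    refine ⟨χ, by rw [h3, h1, pow_succ']; rfl, h4.trans ?_⟩
    calc c * ‖ψ‖ ≤ c * (c ^ n * ‖φ‖) := by gcongr
      _ = c ^ (n + 1) * ‖φ‖ := by ring

theorem LiftsWithBound.exists_clm (hι : Function.Injective ι) {T : H →L[𝕜] H} {c : ℝ}
    (hc : 0 ≤ c) (h : LiftsWithBound ι T c) :
    ∃ U : E →L[𝕜] E, (∀ φ, ι (U φ) = T (ι φ)) ∧ ‖U‖ ≤ c := by
  choose u hu hb using h
  let U : E →ₗ[𝕜] E :=
    { toFun := u
      map_add' := fun x y => hι (by simp [hu])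
      map_smul' := fun a x => hι (by simp [hu]) }
  exact ⟨U.mkContinuous c hb, hu, U.mkContinuous_norm_le hc hb⟩

/-- The image of a closed ball of a Hilbert space under a bounded operator is closed. -/
theorem isClosed_image_closedBall [CompleteSpace E] [CompleteSpace H] (ι : E →L[𝕜] H) (M : ℝ) :
    IsClosed (ι '' Metric.closedBall 0 M) := by
  rw [isClosed_iff_ultrafilter]
  intro w l hl hmem
  have hpre : ∀ᶠ y in (l : Filter H), ∃ v : E, ‖v‖ ≤ M ∧ ι v = y := by
    filter_upwards [hmem] with y hy
    obtain ⟨v, hv, rfl⟩ := hy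
    exact ⟨v, by simpa using hv, rfl⟩
  obtain ⟨v, hv⟩ := hpre.choice
  -- Bounded preimages, viewed as functionals, converge weakly along the ultrafilter by
  -- Banach–Alaoglu; testing against `ι.adjoint ξ` shows that their weak limit is a preimage of `w`.
  let g : H → WeakDual 𝕜 E := fun y => StrongDual.toWeakDual (InnerProductSpace.toDual 𝕜 E (v y))
  obtain ⟨f, hf, hlim⟩ := (WeakDual.isCompact_closedBall (0 : StrongDual 𝕜 E) M).ultrafilter_le_nhds
    (l.map g) (by
      rw [le_principal_iff]
      change ∀ᶠ y in (l : Filter H), g y ∈ _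
      filter_upwards [hv] with y hy
      simpa [g] using hy.1)
  have hlim' : Tendsto g l (𝓝 f) := hlim
  obtain ⟨u, hu⟩ := (InnerProductSpace.toDual 𝕜 E).surjective (WeakDual.toStrongDual f)
  have hfu : ∀ x, f x = ⟪u, x⟫_𝕜 := fun x => by
    rw [← InnerProductSpace.toDual_apply_apply (𝕜 := 𝕜), hu]; rfl
  refine ⟨u, ?_, ?_⟩
  · have hf' : ‖WeakDual.toStrongDual f‖ ≤ M := by simpa using hf
    rw [← hu, LinearIsometryEquiv.norm_map] at hf'
    simpa using hf'
  · refine ext_inner_right 𝕜 fun ξ => ?_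
    have h1 : Tendsto (fun y => (g y) (ι.adjoint ξ)) l (𝓝 (f (ι.adjoint ξ))) :=
      ((WeakBilin.eval_continuous _ (ι.adjoint ξ)).tendsto f).comp hlim'
    rw [hfu, ContinuousLinearMap.adjoint_inner_right] at h1
    refine tendsto_nhds_unique h1 ?_
    have h2 : Tendsto (fun y : H => ⟪y, ξ⟫_𝕜) l (𝓝 ⟪w, ξ⟫_𝕜) :=
      ((continuous_id.inner continuous_const).tendsto w).mono_left hl
    refine h2.congr' ?_
    filter_upwards [hv] with y hy
    change _ = ⟪v y, ι.adjoint ξ⟫_𝕜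
    rw [ContinuousLinearMap.adjoint_inner_right, hy.2]

theorem exists_norm_le_of_tendsto [CompleteSpace E] [CompleteSpace H]
    (hι : Function.Injective ι) {α : Type*} {l : Filter α} [l.NeBot] {w : α → H} {M : α → ℝ}
    {w₀ : H} {M₀ : ℝ} (hw : Tendsto w l (𝓝 w₀)) (hM : Tendsto M l (𝓝 M₀))
    (h : ∀ᶠ a in l, ∃ v, ι v = w a ∧ ‖v‖ ≤ M a) : ∃ v, ι v = w₀ ∧ ‖v‖ ≤ M₀ := by
  -- Since `M a` only tends to `M₀`, some slack is needed to stay in one fixed ball; injectivity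
  -- makes the preimage independent of `M'`.
  have key : ∀ M' > M₀, ∃ v, ι v = w₀ ∧ ‖v‖ ≤ M' := fun M' hM' => by
    have : w₀ ∈ ι '' Metric.closedBall 0 M' := by
      refine (isClosed_image_closedBall ι M').mem_of_tendsto hw ?_
      filter_upwards [h, hM.eventually_le_const hM'] with a ⟨v, hv, hv'⟩ ha
      exact ⟨v, by simpa using hv'.trans ha, hv⟩
    obtain ⟨v, hv, hvw⟩ := this
    exact ⟨v, hvw, by simpa using hv⟩
  obtain ⟨v, hv, -⟩ := key (M₀ + 1) (by linarith)
  refine ⟨v, hv, le_of_forall_gt_imp_ge_of_dense fun M' hM' => ?_⟩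
  obtain ⟨v', hv', hM''⟩ := key M' hM'
  rwa [hι (hv'.trans hv.symm)] at hM''

theorem tendsto_exp_mul_sub_one_div (ω : ℝ) :
    Tendsto (fun h : ℝ≥0 => (Real.exp (ω * h) - 1) / h) (𝓝[>] 0) (𝓝 ω) := by
  have hd : HasDerivAt (fun x : ℝ => Real.exp (ω * x)) ω 0 := by
    simpa using ((hasDerivAt_id (0 : ℝ)).const_mul ω).exp
  have h1 := hd.tendsto_slope_zero_right
  have h2 : Tendsto (fun h : ℝ≥0 => (h : ℝ)) (𝓝[>] 0) (𝓝[>] 0) :=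
    tendsto_nhdsWithin_iff.2 ⟨(NNReal.continuous_coe.tendsto 0).mono_left nhdsWithin_le_nhds,
      by filter_upwards [self_mem_nhdsWithin] with h hh; exact_mod_cast hh⟩
  refine (h1.comp h2).congr fun h => ?_
  simp [div_eq_inv_mul]

/-- If the graph of `B` is approximated by difference quotients of contractions `F h` that act on
`E` with bound `exp (ω h)`, then the resolvents of `B` act on `E` with the corresponding bound. -/
theorem IsResolvent.liftsWithBound [CompleteSpace E] [CompleteSpace H]
    (hι : Function.Injective ι) {B : H →ₗ.[𝕜] H} {F : ℝ≥0 → H →L[𝕜] H} {ω : ℝ}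
    (hF : ∀ h, 0 < h → ‖F h‖ ≤ 1)
    (hFE : ∀ h, 0 < h → LiftsWithBound ι (F h) (Real.exp (ω * h)))
    (hB : (B.graph : Set (H × H)) ⊆ closure {p | Tendsto
      (fun h : ℝ≥0 => ((h : ℝ) : 𝕜)⁻¹ • (p.1 - F h p.1)) (𝓝[>] 0) (𝓝 p.2)})
    {μ : ℝ} (hμ : 0 < μ) (hωμ : ω * μ < 1) {J : H →L[𝕜] H} (hJ : IsResolvent B μ J) :
    LiftsWithBound ι J (1 - ω * μ)⁻¹ := by
  intro φ
  have hμ' : (μ : 𝕜) ≠ 0 := by exact_mod_cast hμ.ne'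
  have hlim : Tendsto (fun h : ℝ≥0 => 1 - (Real.exp (ω * h) - 1) / h * μ) (𝓝[>] 0)
      (𝓝 (1 - ω * μ)) := ((tendsto_exp_mul_sub_one_div ω).mul_const μ).const_sub 1
  -- The approximate resolvent equation is solved inside `E`: multiplied by `h / μ`, its operator is
  -- `(1 + h/μ) - T` with `‖T‖ ≤ exp (ω h)`, invertible for small `h` because `ω μ < 1`.
  have hex : ∀ᶠ h : ℝ≥0 in 𝓝[>] 0, ∃ v : E,
      ι v + ((μ / h : ℝ) : 𝕜) • (ι v - F h (ι v)) = ι φ ∧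
        ‖v‖ ≤ (1 - (Real.exp (ω * h) - 1) / h * μ)⁻¹ * ‖φ‖ := by
    filter_upwards [self_mem_nhdsWithin, hlim.eventually_const_lt (sub_pos.2 hωμ)] with h hh hpos
    have hh0 : (0 : ℝ) < h := by exact_mod_cast hh
    obtain ⟨T, hT, hTn⟩ := (hFE h hh).exists_clm hι (Real.exp_pos _).le
    have hr : 0 < (h : ℝ) / μ := by positivity
    have hkey : 1 - (Real.exp (ω * h) - 1) / h * μ =
        (1 + h / μ - Real.exp (ω * h)) * (μ / h) := by field_simp; ring
    have hpos' : Real.exp (ω * h) < 1 + h / μ := by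
      rw [hkey] at hpos
      exact sub_pos.1 (pos_of_mul_pos_left hpos (by positivity))
    obtain ⟨v, hv, hvn⟩ := exists_smul_sub_apply_eq (𝕜 := 𝕜) hTn hpos' (((h / μ : ℝ) : 𝕜) • φ)
    refine ⟨v, ?_, ?_⟩
    · have h1 := congrArg (fun x => ((μ / h : ℝ) : 𝕜) • ι x) hv
      simp only [map_sub, map_smul, hT, smul_smul, ← RCLike.ofReal_mul] at h1
      have e : μ / h * (h / μ) = 1 := by field_simp
      rw [e, RCLike.ofReal_one, one_smul] at h1
      rw [← h1, smul_sub, smul_sub, smul_smul, ← RCLike.ofReal_mul,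
        show μ / h * (1 + h / μ) = 1 + μ / h by field_simp; ring, RCLike.ofReal_add,
        add_smul, RCLike.ofReal_one, one_smul]
      abel
    · rw [norm_smul, RCLike.norm_ofReal, abs_of_pos hr] at hvn
      rw [inv_mul_eq_div, le_div_iff₀ hpos, hkey]
      calc ‖v‖ * ((1 + h / μ - Real.exp (ω * h)) * (μ / h))
          = ((1 + h / μ - Real.exp (ω * h)) * ‖v‖) * (μ / h) := by ring
        _ ≤ (h / μ * ‖φ‖) * (μ / h) := by gcongr
        _ = ‖φ‖ := by field_simp
  obtain ⟨v, hv⟩ := hex.choice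
  refine exists_norm_le_of_tendsto hι (w := fun h => ι (v h)) ?_
    ((hlim.inv₀ (sub_pos.2 hωμ).ne').mul_const ‖φ‖) (hv.mono fun h hh => ⟨v h, rfl, hh.2⟩)
  rw [Metric.tendsto_nhds]
  intro δ hδ
  set p := J (ι φ) with hp
  set q := (μ : 𝕜)⁻¹ • (ι φ - p) with hq
  have hφ : ι φ = p + (μ : 𝕜) • q := by rw [hq, smul_inv_smul₀ hμ']; abel
  -- The final estimate uses `‖p - x‖` twice and `μ` times two further errors, each below `η`.
  set η := δ / (2 + 2 * μ) with hη
  have hη0 : 0 < η := by positivity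
  obtain ⟨⟨x, y⟩, hxy, hd⟩ := Metric.mem_closure_iff.1 (hB (hJ.mem_graph (ι φ))) η hη0
  have hd1 : ‖p - x‖ < η := by
    rw [← dist_eq_norm]; exact (le_max_left _ _).trans_lt hd
  have hd2 : ‖q - y‖ < η := by
    rw [← dist_eq_norm]; exact (le_max_right _ _).trans_lt hd
  filter_upwards [hv, self_mem_nhdsWithin, Metric.tendsto_nhds.1 hxy η hη0] with h hvh hh hhy
  have hh0 : (0 : ℝ) < h := by exact_mod_cast hh
  have hr : 0 < μ / h := by positivity
  set z := ((h : ℝ) : 𝕜)⁻¹ • (x - F h x) with hz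
  set u := ι (v h) - x with hu
  have hhy' : ‖y - z‖ < η := by rw [← dist_eq_norm, dist_comm]; exact hhy
  have e1 : ((μ / h : ℝ) : 𝕜) • (u - F h u) = (p - x) + (μ : 𝕜) • ((q - y) + (y - z)) - u := by
    have h1 : ((μ / h : ℝ) : 𝕜) • (ι (v h) - F h (ι (v h))) = p + (μ : 𝕜) • q - ι (v h) := by
      rw [← hφ]; exact eq_sub_of_add_eq' hvh.1
    have h2 : ((μ / h : ℝ) : 𝕜) • (x - F h x) = (μ : 𝕜) • z := by
      rw [hz, smul_smul, RCLike.ofReal_div, div_eq_mul_inv]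
    have h3 : u - F h u = (ι (v h) - F h (ι (v h))) - (x - F h x) := by
      rw [hu, map_sub]; abel
    rw [h3, smul_sub, h1, h2, hu, sub_add_sub_cancel, smul_sub]
    abel
  have e2 : ((1 + μ / h : ℝ) : 𝕜) • u =
      ((μ / h : ℝ) : 𝕜) • F h u + ((p - x) + (μ : 𝕜) • ((q - y) + (y - z))) := by
    rw [smul_sub] at e1
    rw [RCLike.ofReal_add, add_smul, RCLike.ofReal_one, one_smul, sub_eq_iff_eq_add.1 e1]
    abel
  -- Contractivity of `F h` on `H` lets the terms in `μ / h`, which blow up as `h → 0`, cancel.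
  have e3 : (1 + μ / h) * ‖u‖ ≤ μ / h * ‖u‖ + (‖p - x‖ + μ * (‖q - y‖ + ‖y - z‖)) := by
    have h1 : (1 + μ / h) * ‖u‖ = ‖((1 + μ / h : ℝ) : 𝕜) • u‖ := by
      rw [norm_smul, RCLike.norm_ofReal, abs_of_pos (by positivity)]
    rw [h1, e2]
    refine (norm_add_le _ _).trans (add_le_add ?_ ((norm_add_le _ _).trans ?_))
    · rw [norm_smul, RCLike.norm_ofReal, abs_of_pos hr]
      gcongr
      simpa using (F h).le_of_opNorm_le (hF h hh) u
    · rw [norm_smul, RCLike.norm_ofReal, abs_of_pos hμ]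
      gcongr
      exact norm_add_le _ _
  have e4 : ι (v h) - p = u - (p - x) := by rw [hu]; abel
  rw [dist_eq_norm, e4]
  refine (norm_sub_le _ _).trans_lt ?_
  have e5 : μ * (‖q - y‖ + ‖y - z‖) < μ * (2 * η) :=
    mul_lt_mul_of_pos_left (by linarith) hμ
  have e6 : (2 + 2 * μ) * η = δ := by rw [hη]; field_simp
  linarith

end Lifting

/-! ### Exponential formula and semigroups on the embedded space -/

section SemigroupLifting

variable {𝕜 : Type*} [RCLike 𝕜] {H E : Type*} [NormedAddCommGroup H] [InnerProductSpace 𝕜 H]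
  [NormedAddCommGroup E] [InnerProductSpace 𝕜 E] {ι : E →L[𝕜] H}

theorem IsC0Semigroup.map_nsmul {X : Type*} [NormedAddCommGroup X] [NormedSpace 𝕜 X]
    {S : ℝ≥0 → X →L[𝕜] X} (hS : IsC0Semigroup S) (n : ℕ) (t : ℝ≥0) : S (n * t) = S t ^ n := by
  induction n with
  | zero => rw [Nat.cast_zero, zero_mul, hS.map_zero, pow_zero]; rfl
  | succ n ih => rw [Nat.cast_succ, add_mul, one_mul, hS.map_add, ih, pow_succ]; rfl

theorem IsC0Semigroup.commute {X : Type*} [NormedAddCommGroup X] [NormedSpace 𝕜 X]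
    {S : ℝ≥0 → X →L[𝕜] X} (hS : IsC0Semigroup S) (s t : ℝ≥0) : Commute (S s) (S t) := by
  change (S s).comp (S t) = (S t).comp (S s)
  rw [← hS.map_add, ← hS.map_add, add_comm]

theorem IsContractionSemigroupOf.map_mem_graph {X : Type*} [NormedAddCommGroup X]
    [NormedSpace 𝕜 X] {B : X →ₗ.[𝕜] X} {S : ℝ≥0 → X →L[𝕜] X}
    (hS : IsContractionSemigroupOf B S) (t : ℝ≥0) {x y : X} (h : (x, y) ∈ B.graph) :
    (S t x, S t y) ∈ B.graph := by
  rw [hS.mem_graph_iff] at h ⊢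
  have h1 := ((S t).continuous.tendsto (-y)).comp h
  rw [map_neg] at h1
  refine h1.congr fun s => ?_
  have h2 : S t (S s x) = S s (S t x) :=
    congrArg (fun T : X →L[𝕜] X => T x) (hS.toIsC0Semigroup.commute t s).eq
  simp [h2]

/-- A contraction semigroup commutes with the resolvents of its generator. -/
theorem IsContractionSemigroupOf.commute_resolvent {B : H →ₗ.[𝕜] H} {S : ℝ≥0 → H →L[𝕜] H}
    (hS : IsContractionSemigroupOf B S) {μ : ℝ} (hμ : μ ≠ 0) {J : H →L[𝕜] H}
    (hJ : IsResolvent B μ J) (t : ℝ≥0) : Commute J (S t) := by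
  have hμ' : (μ : 𝕜) ≠ 0 := by exact_mod_cast hμ
  ext x
  change J (S t x) = S t (J x)
  have h1 := hJ.apply_add (hS.map_mem_graph t (hJ.mem_graph x))
  rw [← h1, map_smul, smul_inv_smul₀ hμ', map_sub]
  congr 1
  abel

/-- The exponential formula `S t x = lim (1 + (t / n) B)⁻ⁿ x`. -/
theorem IsContractionSemigroupOf.tendsto_resolvent_pow [CompleteSpace H] {B : H →ₗ.[𝕜] H}
    (hB : IsMaximalMonotone B) {S : ℝ≥0 → H →L[𝕜] H} (hS : IsContractionSemigroupOf B S)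
    {J : ℝ≥0 → H →L[𝕜] H} (hJ : ∀ μ : ℝ≥0, 0 < μ → IsResolvent B μ (J μ)) {t : ℝ≥0} (ht : 0 < t)
    (x : H) : Tendsto (fun n : ℕ => (J (t / n) ^ n) x) atTop (𝓝 (S t x)) := by
  have hstep : Tendsto (fun n : ℕ => t / (n : ℝ≥0)) atTop (𝓝[>] 0) := by
    refine tendsto_nhdsWithin_iff.2 ⟨?_, ?_⟩
    · rw [← NNReal.tendsto_coe]
      simpa using tendsto_const_div_atTop_nhds_zero_nat (t : ℝ)
    · filter_upwards [eventually_gt_atTop 0] with n hn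
      have : (0 : ℝ≥0) < n := by exact_mod_cast hn
      exact div_pos ht this
  refine tendsto_apply_of_dense (C := 1) ?_ hB.dense_domain (fun x hx => ?_) x
  · filter_upwards [eventually_gt_atTop 0, hstep.eventually self_mem_nhdsWithin] with n hn hh
    exact (norm_pow_le' _ hn).trans (pow_le_one₀ (norm_nonneg _) (hJ _ hh).norm_le_one)
  have hx' := B.mem_graph ⟨x, hx⟩
  set y := B ⟨x, hx⟩ with hy
  -- This expression equals `h⁻¹ (S h x - J h x)`. With `h = t / n`, `t` times its norm is the bound
  -- `n ‖J h x - S h x‖` on the difference of the `n`-th powers.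
  have h1 : Tendsto (fun h : ℝ≥0 => J h y + ((h : ℝ) : 𝕜)⁻¹ • (S h x - x)) (𝓝[>] 0)
      (𝓝 (y + -y)) := (tendsto_resolvent_apply hB hJ y).add ((hS.mem_graph_iff x y).1 hx')
  rw [add_neg_cancel] at h1
  have h2 : Tendsto (fun n : ℕ => (t : ℝ) * ‖J (t / n) y + (((t / n : ℝ≥0) : ℝ) : 𝕜)⁻¹ •
      (S (t / n) x - x)‖) atTop (𝓝 0) := by
    simpa using (h1.comp hstep).norm.const_mul (t : ℝ)
  rw [tendsto_iff_norm_sub_tendsto_zero]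
  refine squeeze_zero' (Eventually.of_forall fun _ => norm_nonneg _) ?_ h2
  filter_upwards [eventually_gt_atTop 0, hstep.eventually self_mem_nhdsWithin] with n hn hh
  have hn0 : (n : ℝ≥0) ≠ 0 := by exact_mod_cast hn.ne'
  set h := t / (n : ℝ≥0) with hdef
  have hh0 : (0 : ℝ) < h := by exact_mod_cast (show (0 : ℝ≥0) < h from hh)
  have hSt : S t = S h ^ n := by
    rw [← hS.toIsC0Semigroup.map_nsmul, hdef, mul_div_cancel₀ _ hn0]
  have hnt : (n : ℝ) = t * (h : ℝ)⁻¹ := by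
    have : (n : ℝ) ≠ 0 := by exact_mod_cast hn.ne'
    have h3 : (0 : ℝ) < t := by exact_mod_cast ht
    rw [hdef]; push_cast; field_simp
  rw [hSt]
  refine (norm_pow_apply_sub_pow_apply_le (hJ h hh).norm_le_one (hS.norm_le_one h)
    (hS.commute_resolvent hh0.ne' (hJ h hh) h) n x).trans (le_of_eq ?_)
  have h4 : J h y + ((h : ℝ) : 𝕜)⁻¹ • (S h x - x) = ((h : ℝ) : 𝕜)⁻¹ • -(J h x - S h x) := by
    rw [(hJ h hh).apply_snd hh0.ne' hx', ← smul_add]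
    congr 1
    abel
  rw [h4, norm_smul, norm_neg, norm_inv, RCLike.norm_ofReal, abs_of_pos hh0, hnt]
  ring

/-- The `n`-th power of the resolvent at `t / n` has bound `(1 - ω t / n)⁻ⁿ → exp (ω t)` on `E`, and
the exponential formula supplies the limit in `H`. -/
theorem IsContractionSemigroupOf.liftsWithBound [CompleteSpace H] [CompleteSpace E]
    (hι : Function.Injective ι) {B : H →ₗ.[𝕜] H} (hB : IsMaximalMonotone B)
    {S : ℝ≥0 → H →L[𝕜] H} (hS : IsContractionSemigroupOf B S) {ω : ℝ}
    (hJ : ∀ (μ : ℝ) (J : H →L[𝕜] H), 0 < μ → ω * μ < 1 → IsResolvent B μ J →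
      LiftsWithBound ι J (1 - ω * μ)⁻¹) (t : ℝ≥0) :
    LiftsWithBound ι (S t) (Real.exp (ω * t)) := by
  rcases eq_zero_or_pos t with rfl | ht
  · intro φ
    exact ⟨φ, by rw [hS.map_zero]; rfl, by simp⟩
  obtain ⟨R, hR⟩ := hB.exists_resolvents
  intro φ
  have hexp : Tendsto (fun n : ℕ => ((1 - ω * ((t / n : ℝ≥0) : ℝ))⁻¹) ^ n) atTop
      (𝓝 (Real.exp (ω * t))) := by
    have h1 := (Real.tendsto_one_add_div_pow_exp (-(ω * t))).inv₀ (Real.exp_pos _).ne'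
    rw [← Real.exp_neg, neg_neg] at h1
    refine h1.congr fun n => ?_
    rw [inv_pow]
    push_cast
    congr 2
    ring
  have hlt : ∀ᶠ n : ℕ in atTop, ω * ((t / n : ℝ≥0) : ℝ) < 1 := by
    have h1 : Tendsto (fun n : ℕ => ω * ((t / n : ℝ≥0) : ℝ)) atTop (𝓝 0) := by
      have := (tendsto_const_div_atTop_nhds_zero_nat (t : ℝ)).const_mul ω
      simpa using this
    exact h1.eventually_lt_const one_pos
  refine exists_norm_le_of_tendsto hι (hS.tendsto_resolvent_pow hB hR ht (ι φ))
    (hexp.mul_const ‖φ‖) ?_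
  filter_upwards [hlt, eventually_gt_atTop 0] with n hn hn0
  have hh : (0 : ℝ≥0) < t / n := div_pos ht (by exact_mod_cast hn0)
  exact (hJ _ _ (by exact_mod_cast hh) hn (hR _ hh)).pow
    (inv_nonneg.2 (sub_nonneg.2 hn.le)) n φ

/-- A semigroup satisfying an exponential bound is strongly continuous if it is so at `0`. -/
theorem continuous_orbit_of_tendsto_zero {S : ℝ≥0 → E →L[𝕜] E} {ω : ℝ} (hω : 0 ≤ ω)
    (hadd : ∀ s t, S (s + t) = (S s).comp (S t)) (hb : ∀ t, ‖S t‖ ≤ Real.exp (ω * t)) {x : E}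
    (hx : Tendsto (fun t => S t x) (𝓝 0) (𝓝 x)) : Continuous fun t => S t x := by
  have key : ∀ s t : ℝ≥0, s ≤ t → ‖S t x - S s x‖ ≤ Real.exp (ω * s) * ‖S (t - s) x - x‖ := by
    intro s t hst
    have h1 : S t x = S s (S (t - s) x) := by
      conv_lhs => rw [← add_tsub_cancel_of_le hst, hadd]
      rfl
    rw [h1, ← map_sub]
    exact (S s).le_of_opNorm_le (hb s) _
  rw [continuous_iff_continuousAt]
  intro t
  -- With truncated subtraction, this sum is `|s - t|`.
  have h0 : Tendsto (fun s : ℝ≥0 => (s - t) + (t - s)) (𝓝 t) (𝓝 0) := by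
    have : Continuous fun s : ℝ≥0 => (s - t) + (t - s) := by fun_prop
    simpa using this.tendsto t
  have h1 : Tendsto (fun s : ℝ≥0 => Real.exp (ω * t) * ‖S ((s - t) + (t - s)) x - x‖) (𝓝 t)
      (𝓝 0) := by
    simpa using ((tendsto_iff_norm_sub_tendsto_zero.1 hx).comp h0).const_mul (Real.exp (ω * t))
  refine tendsto_iff_norm_sub_tendsto_zero.2
    (squeeze_zero (fun _ => norm_nonneg _) (fun s => ?_) h1)
  rcases le_total s t with hst | hst
  · rw [norm_sub_rev, tsub_eq_zero_of_le hst, zero_add]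
    refine (key s t hst).trans ?_
    gcongr
  · rw [tsub_eq_zero_of_le hst, add_zero]
    exact key t s hst

theorem exists_isQuasiContractionSemigroup_lift [CompleteSpace H] [CompleteSpace E]
    (hι : Function.Injective ι) {S : ℝ≥0 → H →L[𝕜] H} (hS : IsC0Semigroup S) {ω : ℝ}
    (hω : 0 ≤ ω) (h : ∀ t, LiftsWithBound ι (S t) (Real.exp (ω * t))) :
    ∃ T : ℝ≥0 → E →L[𝕜] E, (∀ t φ, ι (T t φ) = S t (ι φ)) ∧ IsQuasiContractionSemigroup T := by
  choose T hT hTn using fun t => (h t).exists_clm hι (Real.exp_pos _).le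
  have hadd : ∀ s t, T (s + t) = (T s).comp (T t) := fun s t => by
    ext φ
    apply hι
    simp only [ContinuousLinearMap.comp_apply, hT, hS.map_add]
  refine ⟨T, hT, ⟨⟨?_, hadd, fun φ => ?_⟩, ω, hTn⟩⟩
  · ext φ
    apply hι
    simp [hT, hS.map_zero]
  refine continuous_orbit_of_tendsto_zero hω hadd hTn ?_
  have hexp : ∀ c : ℝ, Tendsto (fun t : ℝ≥0 => Real.exp (ω * t) * c) (𝓝 0) (𝓝 c) := fun c => by
    have : Continuous fun t : ℝ≥0 => Real.exp (ω * t) * c := by fun_prop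
    simpa using this.tendsto 0
  -- Pairing with a vector `ι.adjoint ξ` moves the orbit to `H`, where it is continuous; density
  -- (from injectivity of `ι`) gives weak continuity at `0`.
  have hdense : Dense (Set.range ι.adjoint) := by
    have h1 : (LinearMap.range (ι.adjoint : H →ₗ[𝕜] E))ᗮ = ⊥ := by
      refine (ContinuousLinearMap.orthogonal_range ι.adjoint).trans ?_
      rw [ContinuousLinearMap.adjoint_adjoint]
      exact LinearMap.ker_eq_bot.2 hι
    have h2 := Submodule.dense_iff_topologicalClosure_eq_top.2
      (Submodule.topologicalClosure_eq_top_iff.2 h1)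
    simpa [LinearMap.coe_range] using h2
  have hweak : Tendsto (fun t => innerSL 𝕜 (T t φ) φ) (𝓝 0) (𝓝 (innerSL 𝕜 φ φ)) := by
    refine tendsto_apply_of_dense (C := 1 * ‖φ‖ + 1) ?_ hdense ?_ φ
    · filter_upwards [(hexp ‖φ‖).eventually_le_const (show ‖φ‖ < 1 * ‖φ‖ + 1 by linarith)]
        with t ht
      rw [innerSL_apply_norm]
      exact ((T t).le_of_opNorm_le (hTn t) φ).trans ht
    · rintro _ ⟨ξ, rfl⟩
      simp only [innerSL_apply_apply, ContinuousLinearMap.adjoint_inner_right, hT]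
      have h1 : Continuous fun t => ⟪S t (ι φ), ξ⟫_𝕜 :=
        (hS.continuous_orbit (ι φ)).inner continuous_const
      have h2 := h1.tendsto 0
      rwa [hS.map_zero] at h2
  have hre : Tendsto (fun t => RCLike.re ⟪T t φ, φ⟫_𝕜) (𝓝 0) (𝓝 (‖φ‖ ^ 2)) := by
    have h1 := (RCLike.continuous_re.tendsto _).comp hweak
    rw [innerSL_apply_apply, inner_self_eq_norm_sq] at h1
    exact h1
  -- Weak convergence with `‖T t φ‖ ≤ exp (ω t) ‖φ‖` upgrades to norm convergence by expanding the
  -- square.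
  have hsq : Tendsto (fun t => ‖T t φ - φ‖ ^ 2) (𝓝 0) (𝓝 0) := by
    have h1 : Tendsto (fun t : ℝ≥0 => (Real.exp (ω * t) * ‖φ‖) ^ 2 - 2 * RCLike.re ⟪T t φ, φ⟫_𝕜
        + ‖φ‖ ^ 2) (𝓝 0) (𝓝 (‖φ‖ ^ 2 - 2 * ‖φ‖ ^ 2 + ‖φ‖ ^ 2)) :=
      (((hexp ‖φ‖).pow 2).sub (hre.const_mul 2)).add_const _
    rw [show ‖φ‖ ^ 2 - 2 * ‖φ‖ ^ 2 + ‖φ‖ ^ 2 = 0 by ring] at h1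
    refine squeeze_zero (fun _ => by positivity) (fun t => ?_) h1
    rw [norm_sub_sq (𝕜 := 𝕜)]
    have := (T t).le_of_opNorm_le (hTn t) φ
    gcongr
  rw [tendsto_iff_norm_sub_tendsto_zero]
  have h3 := hsq.sqrt
  simpa [Real.sqrt_sq (norm_nonneg _)] using h3

end SemigroupLifting

/-! ### The spaces `D(G^k)` and consistency of the products with `A + εG` -/

section Powers

variable {𝕜 : Type*} [RCLike 𝕜] {H : Type*} [NormedAddCommGroup H] [InnerProductSpace 𝕜 H]

theorem mem_graph_opPow_zero {G : H →ₗ.[𝕜] H} {x y : H} :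
    (x, y) ∈ (opPow G 0).graph ↔ x = y := by
  rw [LinearPMap.mem_graph_iff]
  constructor
  · rintro ⟨z, rfl, rfl⟩
    rfl
  · rintro rfl
    exact ⟨⟨x, trivial⟩, rfl, rfl⟩

theorem mem_graph_opPow_succ {G : H →ₗ.[𝕜] H} {k : ℕ} {x y : H} :
    (x, y) ∈ (opPow G (k + 1)).graph ↔ ∃ z, (x, z) ∈ (opPow G k).graph ∧ (z, y) ∈ G.graph := by
  constructor
  · intro h
    obtain ⟨⟨w, hw⟩, rfl, rfl⟩ := (LinearPMap.mem_graph_iff _).1 h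
    obtain ⟨h1, h2⟩ := (mem_compose_domain_iff G (opPow G k) w).1 hw
    exact ⟨_, (opPow G k).mem_graph ⟨w, h1⟩, G.mem_graph ⟨_, h2⟩⟩
  · rintro ⟨z, hxz, hzy⟩
    obtain ⟨⟨w, h1⟩, rfl, rfl⟩ := (LinearPMap.mem_graph_iff _).1 hxz
    obtain ⟨⟨v, h2⟩, hv, rfl⟩ := (LinearPMap.mem_graph_iff _).1 hzy
    change v = opPow G k ⟨w, h1⟩ at hv
    subst hv
    exact (opPow G (k + 1)).mem_graph ⟨w, (mem_compose_domain_iff G (opPow G k) w).2 ⟨h1, h2⟩⟩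

/-- Resolvents of `G` commute with the powers of `G`. -/
theorem IsResolvent.map_mem_graph_opPow {G : H →ₗ.[𝕜] H} {μ : ℝ} (hμ : μ ≠ 0) {J : H →L[𝕜] H}
    (hJ : IsResolvent G μ J) (k : ℕ) {x y : H} (h : (x, y) ∈ (opPow G k).graph) :
    (J x, J y) ∈ (opPow G k).graph := by
  induction k generalizing y with
  | zero => rw [mem_graph_opPow_zero] at h ⊢; rw [h]
  | succ k ih =>
    obtain ⟨z, h1, h2⟩ := mem_graph_opPow_succ.1 h
    exact mem_graph_opPow_succ.2 ⟨J z, ih h1, hJ.map_mem_graph hμ h2⟩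

namespace PowDomain

variable (G : H →ₗ.[𝕜] H) (k : ℕ)

theorem mem_graph_pow (j : Fin (k + 1)) (x : PowDomain G k) :
    (incl G k x, pow G k j x) ∈ (opPow G j).graph :=
  (opPow G j).mem_graph (Submodule.inclusion (opPow_domain_antitone G (Nat.lt_succ_iff.1 j.2)) x)

theorem pow_eq_of_mem_graph {j : Fin (k + 1)} {x : PowDomain G k} {y : H}
    (h : (incl G k x, y) ∈ (opPow G j).graph) : pow G k j x = y :=
  LinearPMap.mem_graph_snd_inj _ (mem_graph_pow G k j x) h rfl

theorem norm_sq_eq (x : PowDomain G k) : ‖x‖ ^ 2 = ∑ j, ‖pow G k j x‖ ^ 2 := by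
  rw [← inner_self_eq_norm_sq (𝕜 := 𝕜), inner_def, map_sum]
  simp only [inner_self_eq_norm_sq]

theorem norm_pow_le (j : Fin (k + 1)) (x : PowDomain G k) : ‖pow G k j x‖ ≤ ‖x‖ := by
  refine le_of_sq_le_sq ?_ (norm_nonneg x)
  rw [norm_sq_eq]
  exact Finset.single_le_sum (f := fun j => ‖pow G k j x‖ ^ 2) (fun _ _ => sq_nonneg _)
    (Finset.mem_univ j)

/-- The inclusion of `D(G ^ k)` into `H` as a bounded operator. -/
noncomputable def inclL : PowDomain G k →L[𝕜] H :=
  (incl G k).mkContinuous 1 fun x => by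
    rw [one_mul, ← pow_zero_apply]
    exact norm_pow_le G k 0 x

theorem inclL_injective : Function.Injective (inclL G k) := Subtype.val_injective

variable {G k}

theorem exists_incl_eq {x y : H} (h : (x, y) ∈ (opPow G k).graph) :
    ∃ φ : PowDomain G k, incl G k φ = x :=
  ⟨(⟨x, LinearPMap.mem_domain_of_mem_graph h⟩ : (opPow G k).domain), rfl⟩

theorem completeSpace [CompleteSpace H] (hG : IsClosed (G.graph : Set (H × H))) :
    CompleteSpace (PowDomain G k) := by
  refine Metric.complete_of_cauchySeq_tendsto fun u hu => ?_
  have hc : ∀ j, CauchySeq fun n => pow G k j (u n) := fun j =>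
    hu.map (((pow G k j).mkContinuous 1 fun x => by
      rw [one_mul]; exact norm_pow_le G k j x).uniformContinuous)
  choose y hy using fun j => cauchySeq_tendsto_of_complete (hc j)
  -- Only `G` is known to be closed, so the limits are linked one power at a time.
  have hmem : ∀ j : ℕ, ∀ hj : j < k + 1, (y 0, y ⟨j, hj⟩) ∈ (opPow G j).graph := by
    intro j
    induction j with
    | zero => exact fun _ => mem_graph_opPow_zero.2 rfl
    | succ j ih =>
      intro hj
      refine mem_graph_opPow_succ.2 ⟨_, ih (by omega), ?_⟩
      refine hG.mem_of_tendsto ((hy ⟨j, by omega⟩).prodMk_nhds (hy ⟨j + 1, hj⟩))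
        (Eventually.of_forall fun n => ?_)
      obtain ⟨z, h1, h2⟩ := mem_graph_opPow_succ.1 (mem_graph_pow G k ⟨j + 1, hj⟩ (u n))
      rwa [← pow_eq_of_mem_graph G k (j := ⟨j, by omega⟩) h1] at h2
  obtain ⟨φ, hφ⟩ := exists_incl_eq (hmem k k.lt_succ_self)
  have hφy : ∀ j, pow G k j φ = y j := fun j =>
    pow_eq_of_mem_graph G k (by rw [hφ]; exact hmem j j.2)
  refine ⟨φ, tendsto_iff_norm_sub_tendsto_zero.2 ?_⟩
  have hsq : Tendsto (fun n => ‖u n - φ‖ ^ 2) atTop (𝓝 0) := by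
    simp only [norm_sq_eq, map_sub, hφy]
    have : Tendsto (fun n => ∑ j, ‖pow G k j (u n) - y j‖ ^ 2) atTop
        (𝓝 (∑ _j : Fin (k + 1), (0 : ℝ) ^ 2)) :=
      tendsto_finsetSum _ fun j _ => (tendsto_iff_norm_sub_tendsto_zero.1 (hy j)).pow 2
    simpa using this
  simpa [Real.sqrt_sq (norm_nonneg _)] using hsq.sqrt

/-- An operator acts boundedly on `D(G ^ k)` if it does so for each of the seminorms
`‖G ^ j x‖`, `j ≤ k`. -/
theorem liftsWithBound {T : H →L[𝕜] H} {c : ℝ} (hc : 0 ≤ c)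
    (h : ∀ j ≤ k, ∀ x y, (x, y) ∈ (opPow G j).graph →
      ∃ z, (T x, z) ∈ (opPow G j).graph ∧ ‖z‖ ≤ c * ‖y‖) :
    LiftsWithBound (inclL G k) T c := by
  intro φ
  choose z hz hzn using fun j : Fin (k + 1) =>
    h j (Nat.lt_succ_iff.1 j.2) _ _ (mem_graph_pow G k j φ)
  obtain ⟨ψ, hψ⟩ : ∃ ψ : PowDomain G k, incl G k ψ = _ := exists_incl_eq (hz (Fin.last k))
  refine ⟨ψ, hψ, ?_⟩
  refine le_of_sq_le_sq ?_ (by positivity)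
  rw [mul_pow, norm_sq_eq, norm_sq_eq, Finset.mul_sum]
  refine Finset.sum_le_sum fun j _ => ?_
  rw [pow_eq_of_mem_graph G k (show (incl G k ψ, z j) ∈ _ by rw [hψ]; exact hz j), ← mul_pow]
  gcongr
  exact hzn j

end PowDomain

/-- Closability is not needed: by convention the closure of a non-closable operator is the operator
itself. -/
theorem graph_closure_subset (T : H →ₗ.[𝕜] H) :
    (T.closure.graph : Set (H × H)) ⊆ closure (T.graph : Set (H × H)) := by
  by_cases hT : T.IsClosable
  · rw [← hT.graph_closure_eq_closure_graph, Submodule.topologicalClosure_coe]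
  · rw [LinearPMap.closure_def' hT]
    exact subset_closure

/-- The products `(1 + h ε G)⁻¹ S_A(h)` are consistent with `A + ε G`. -/
theorem tendsto_difference_quotient [CompleteSpace H] {A G : H →ₗ.[𝕜] H}
    (hG : IsMaximalMonotone G) {SA : ℝ≥0 → H →L[𝕜] H} (hSA : IsContractionSemigroupOf A SA)
    {ε : ℝ≥0} (hε : 0 < ε) {J : ℝ≥0 → H →L[𝕜] H}
    (hJ : ∀ μ : ℝ≥0, 0 < μ → IsResolvent G μ (J μ)) {x y : H}
    (h : (x, y) ∈ (A + ((ε : ℝ) : 𝕜) • G).graph) :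
    Tendsto (fun h : ℝ≥0 => ((h : ℝ) : 𝕜)⁻¹ • (x - J (ε * h) (SA h x))) (𝓝[>] 0) (𝓝 y) := by
  obtain ⟨hxA, hxG⟩ : x ∈ A.domain ∧ x ∈ G.domain := LinearPMap.mem_domain_of_mem_graph h
  have hAx := A.mem_graph ⟨x, hxA⟩
  have hGx := G.mem_graph ⟨x, hxG⟩
  obtain rfl : y = A ⟨x, hxA⟩ + ((ε : ℝ) : 𝕜) • G ⟨x, hxG⟩ :=
    LinearPMap.mem_graph_snd_inj _ h ((A + ((ε : ℝ) : 𝕜) • G).mem_graph ⟨x, hxA, hxG⟩) rfl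
  generalize A ⟨x, hxA⟩ = a at hAx ⊢
  generalize G ⟨x, hxG⟩ = g at hGx ⊢
  have hlim : Tendsto (fun h : ℝ≥0 => ε * h) (𝓝[>] 0) (𝓝[>] 0) := by
    refine tendsto_nhdsWithin_iff.2 ⟨?_, ?_⟩
    · have : Tendsto (fun h : ℝ≥0 => ε * h) (𝓝 0) (𝓝 (ε * 0)) :=
        (continuous_const.mul continuous_id).tendsto 0
      rw [mul_zero] at this
      exact this.mono_left nhdsWithin_le_nhds
    · filter_upwards [self_mem_nhdsWithin] with h hh
      exact mul_pos hε hh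
  have hJ1 : ∀ z, Tendsto (fun h : ℝ≥0 => J (ε * h) z) (𝓝[>] 0) (𝓝 z) := fun z =>
    (tendsto_resolvent_apply hG hJ z).comp hlim
  have hq : Tendsto (fun h : ℝ≥0 => ((h : ℝ) : 𝕜)⁻¹ • (SA h x - x) + a) (𝓝[>] 0) (𝓝 0) := by
    simpa using ((hSA.mem_graph_iff x a).1 hAx).add_const a
  have hJq : Tendsto (fun h : ℝ≥0 => J (ε * h) (((h : ℝ) : 𝕜)⁻¹ • (SA h x - x) + a)) (𝓝[>] 0)
      (𝓝 0) := by
    refine squeeze_zero_norm' ?_ (tendsto_zero_iff_norm_tendsto_zero.1 hq)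
    filter_upwards [hlim.eventually self_mem_nhdsWithin] with h hh
    simpa using (J (ε * h)).le_of_opNorm_le (hJ _ hh).norm_le_one
      (((h : ℝ) : 𝕜)⁻¹ • (SA h x - x) + a)
  -- With `J = J (ε h)` and `x - J x = ε h J g`, the quotient is exactly `J a - J (h⁻¹ (S_A(h) x -
  -- x) + a) + ε J g`.
  have hmain := ((hJ1 a).sub hJq).add ((hJ1 g).const_smul (((ε : ℝ) : 𝕜)))
  rw [sub_zero] at hmain
  refine hmain.congr' ?_
  filter_upwards [self_mem_nhdsWithin] with h hh
  have hh0 : (0 : ℝ) < h := by exact_mod_cast (show (0 : ℝ≥0) < h from hh)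
  have hε0 : (0 : ℝ) < ε := by exact_mod_cast hε
  have hε' : ((ε : ℝ) : 𝕜) ≠ 0 := by exact_mod_cast hε0.ne'
  rw [(hJ _ (mul_pos hε hh)).apply_snd (NNReal.coe_ne_zero.2 (mul_pos hε hh).ne') hGx]
  simp only [map_add, map_smul, map_sub, NNReal.coe_mul, RCLike.ofReal_mul, mul_inv, smul_smul,
    mul_inv_cancel_left₀ hε', smul_sub]
  abel

end Powers

end OpSemigroup

/-! ### The main theorem -/

theorem mainTheorem7 {𝕜 : Type*} [RCLike 𝕜] {H : Type*} [NormedAddCommGroup H]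
    [InnerProductSpace 𝕜 H] [CompleteSpace H]
    (A G : H →ₗ.[𝕜] H)
    (hA : OpSemigroup.IsMaximalMonotone A) (hG : OpSemigroup.IsMaximalMonotone G)
    (SA : ℝ≥0 → H →L[𝕜] H) (hSA : OpSemigroup.IsContractionSemigroupOf A SA)
    (ε₀ : ℝ) (hε₀ : 0 < ε₀)
    (hsum : ∀ ε : ℝ, 0 < ε → ε ≤ ε₀ →
      OpSemigroup.IsMaximalMonotone (A + (ε : 𝕜) • G).closure)
    (m : ℕ) (hm : 1 ≤ m) (α : ℕ → ℝ)
    (hSG : ∀ k : ℕ, 1 ≤ k → k ≤ m + 1 →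
      ∀ (φ : (OpSemigroup.opPow G k).domain) (t : ℝ≥0),
        ∃ h : SA t (φ : H) ∈ (OpSemigroup.opPow G k).domain,
          ‖OpSemigroup.opPow G k ⟨SA t (φ : H), h⟩‖
            ≤ Real.exp (α k * t) * ‖OpSemigroup.opPow G k φ‖) :
    ∀ k : ℕ, 1 ≤ k → k ≤ m + 1 →
      CompleteSpace (OpSemigroup.PowDomain G k) ∧
      OpSemigroup.RestrictsToQuasiContractionSemigroup SA G k ∧
      ∀ ε : ℝ, 0 < ε → ε ≤ ε₀ →
        ∀ Sε : ℝ≥0 → H →L[𝕜] H,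
          OpSemigroup.IsContractionSemigroupOf (A + (ε : 𝕜) • G).closure Sε →
            OpSemigroup.RestrictsToQuasiContractionSemigroup Sε G k := by
  intro k _ hkm
  have : CompleteSpace (OpSemigroup.PowDomain G k) :=
    OpSemigroup.PowDomain.completeSpace hG.isClosed_graph
  have hι := OpSemigroup.PowDomain.inclL_injective G k
  -- A single nonnegative rate dominating every `α j` with `1 ≤ j ≤ k`; nonnegativity covers `j =
  -- 0`, where `S_A` is a contraction. It does not depend on `ε`.
  set ω : ℝ := ∑ j ∈ Finset.range (k + 1), |α j| with hω
  have hω0 : 0 ≤ ω := Finset.sum_nonneg fun _ _ => abs_nonneg _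
  have hbound : ∀ (t : ℝ≥0), ∀ j ≤ k, ∀ x y, (x, y) ∈ (OpSemigroup.opPow G j).graph →
      ∃ z, (SA t x, z) ∈ (OpSemigroup.opPow G j).graph ∧ ‖z‖ ≤ Real.exp (ω * t) * ‖y‖ := by
    intro t j hj x y hxy
    rcases j.eq_zero_or_pos with rfl | hj0
    · rw [OpSemigroup.mem_graph_opPow_zero] at hxy
      refine ⟨SA t x, OpSemigroup.mem_graph_opPow_zero.2 rfl, ?_⟩
      rw [← hxy]
      refine ((SA t).le_of_opNorm_le (hSA.norm_le_one t) x).trans ?_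
      gcongr
      exact Real.one_le_exp (by positivity)
    · obtain ⟨φ, rfl, rfl⟩ := (LinearPMap.mem_graph_iff _).1 hxy
      obtain ⟨h1, h2⟩ := hSG j hj0 (hj.trans hkm) φ t
      refine ⟨_, (OpSemigroup.opPow G j).mem_graph ⟨_, h1⟩, h2.trans ?_⟩
      gcongr
      exact (le_abs_self _).trans (Finset.single_le_sum (f := fun j => |α j|)
        (fun _ _ => abs_nonneg _) (Finset.mem_range.2 (Nat.lt_succ_of_le hj)))
  refine ⟨this, ?_, fun ε hε hεε₀ Sε hSε => ?_⟩
  · exact OpSemigroup.exists_isQuasiContractionSemigroup_lift hι hSA.toIsC0Semigroup hω0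
      fun t => OpSemigroup.PowDomain.liftsWithBound (Real.exp_pos _).le (hbound t)
  obtain ⟨J, hJ⟩ := hG.exists_resolvents
  lift ε to ℝ≥0 using hε.le
  have hε' : 0 < ε := by exact_mod_cast hε
  have hB := hsum ε hε hεε₀
  refine OpSemigroup.exists_isQuasiContractionSemigroup_lift hι hSε.toIsC0Semigroup hω0
    (hSε.liftsWithBound hι hB fun μ R hμ hωμ hR => ?_)
  refine hR.liftsWithBound hι (F := fun h => (J (ε * h)).comp (SA h)) (fun h hh => ?_)
    (fun h hh => OpSemigroup.PowDomain.liftsWithBound (Real.exp_pos _).le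
      fun j hj x y hxy => ?_) ?_ hμ hωμ
  · exact ((J (ε * h)).opNorm_comp_le (SA h)).trans
      (mul_le_one₀ (hJ _ (mul_pos hε' hh)).norm_le_one (norm_nonneg _) (hSA.norm_le_one h))
  · have hJh := hJ _ (mul_pos hε' hh)
    obtain ⟨z, h1, h2⟩ := hbound h j hj x y hxy
    refine ⟨J (ε * h) z, hJh.map_mem_graph_opPow (NNReal.coe_ne_zero.2 (mul_pos hε' hh).ne') j h1,
      le_trans ?_ h2⟩
    simpa using (J (ε * h)).le_of_opNorm_le hJh.norm_le_one z
  · exact (OpSemigroup.graph_closure_subset _).trans (closure_mono fun p hp =>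
      OpSemigroup.tendsto_difference_quotient hG hSA hε' hJ hp)
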